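/- Let $q=3^m$ with $m\ge 1$, and let $n\ge 2$ be an integer. Let $$R_q(n,n)=\{f\in\mathbb F_q[X_1,\dots,X_n]:\ \deg f\le n,\ \deg_{X_j}f\le q-1\ \text{for } 1\le j\le n\}$$ be the $q$-ary Reed-Muller code of degree $n$ in $n$ variables, where $\deg$ is the total degree and $\deg_{X_j}$ is the degree in $X_j$. For $f\in R_q(n,n)$ let $|f|=q^n-|\{x\in\mathbb F_q^n: f(x)=0\}|$ be its Hamming weight. Then $$\bigl|\{f\in R_q(n,n):\ 3 \text{ divides } |f|\}\bigr|=q^{\dim_{\mathbb F_q}R_q(n,n)-1},$$ where $$\dim_{\mathbb F_q}R_q(n,n)=\sum_{0\le j\le\lfloor n/q\rfloor}(-1)^j\binom nj\binom{2n-qj}{n}.$$ -/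

import Mathlib

/-- The `q`-ary Reed-Muller code `R_q(d, n)` over the finite field `K` with `q` elements: the
polynomials in `n` variables of total degree at most `d` and of degree at most `q - 1` in each
variable, as a `K`-subspace of the polynomial ring. -/
noncomputable def reedMuller (K : Type*) [Field K] [Fintype K] (d n : ℕ) :
    Submodule K (MvPolynomial (Fin n) K) :=
  MvPolynomial.restrictTotalDegree (Fin n) K d ⊓
    MvPolynomial.restrictDegree (Fin n) K (Fintype.card K - 1)

theorem mem_reedMuller {K : Type*} [Field K] [Fintype K] {d n : ℕ}
    {f : MvPolynomial (Fin n) K} :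
    f ∈ reedMuller K d n ↔
      f.totalDegree ≤ d ∧ ∀ j, MvPolynomial.degreeOf j f ≤ Fintype.card K - 1 := by
  simp only [reedMuller, Submodule.mem_inf, MvPolynomial.mem_restrictTotalDegree,
    MvPolynomial.mem_restrictDegree, MvPolynomial.degreeOf_le_iff]
  exact and_congr_right fun _ => ⟨fun h j s hs => h s hs j, fun h s hs j => h j s hs⟩

open Classical in
/-- The Hamming weight of (the evaluation vector of) `f`: the number of points of `K ^ n` at
which `f` does not vanish. -/
noncomputable def codewordWeight {K : Type*} [Field K] [Fintype K] {n : ℕ}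
    (f : MvPolynomial (Fin n) K) : ℕ :=
  hammingNorm (fun x : Fin n → K => MvPolynomial.eval x f)

open Classical in
theorem codewordWeight_eq {K : Type*} [Field K] [Fintype K] {n : ℕ}
    (f : MvPolynomial (Fin n) K) :
    codewordWeight f = Fintype.card K ^ n -
      (Finset.univ.filter fun x : Fin n → K => MvPolynomial.eval x f = 0).card := by
  have h := Finset.card_filter_add_card_filter_not (s := (Finset.univ : Finset (Fin n → K)))
    (fun x => MvPolynomial.eval x f = 0)
  rw [Finset.card_univ, Fintype.card_fun, Fintype.card_fin] at h
  rw [← h, codewordWeight, hammingNorm, Nat.add_sub_cancel_left]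

open Finset

namespace MvPolynomial

/-! In `K` the weight of `f` is the sum of the values of `f ^ (q - 1)`, hence up to sign the
coefficient of `f ^ (q - 1)` at `(q - 1, …, q - 1)` (`sum_eval_eq_coeff`). As `deg f ≤ n`, a
Frobenius recursion (`coeff_constExponent_pow_succ`) shows that this vanishes exactly when the
coefficient of `f ^ (p - 1)` at `(p - 1, …, p - 1)` does.

For `p = 3` that is the coefficient of `f ^ 2` at `(2, …, 2)`, a quadratic form in the coefficients
of `f`: a hyperbolic plane for each pair of distinct complementary exponents of degree `n`, plus the
square of the coefficient at `(1, …, 1)`. Such a form vanishes on exactly a `1 / q` share of the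
code; `shiftParameter` and `Nat.card_eq_mul_card_of_shift` make this bijective. The dimension counts
monomials by a generating function. -/

theorem coeff_eq_zero_of_totalDegree_lt_degree {σ R : Type*} [CommSemiring R]
    {f : MvPolynomial σ R} {u : σ →₀ ℕ} (h : f.totalDegree < u.degree) : coeff u f = 0 := by
  refine coeff_eq_zero_of_totalDegree_lt ?_
  rwa [Finsupp.degree_apply] at h

section Exponents

variable {σ : Type*} [Fintype σ]

/-- The exponent vector all of whose entries are `k`. -/
noncomputable def constExponent (σ : Type*) [Fintype σ] (k : ℕ) : σ →₀ ℕ :=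
  Finsupp.equivFunOnFinite.symm fun _ => k

@[simp]
theorem constExponent_apply (k : ℕ) (i : σ) : constExponent σ k i = k := rfl

theorem degree_constExponent (k : ℕ) : (constExponent σ k).degree = Fintype.card σ * k := by
  simp [Finsupp.degree_eq_sum]

/-- An exponent vector with entries at least `k` and degree at most `k` times the number of
variables is constant. -/
theorem eq_constExponent_of_le {k : ℕ} {u : σ →₀ ℕ} (h : ∀ i, k ≤ u i)
    (hd : u.degree ≤ Fintype.card σ * k) : u = constExponent σ k := by
  have hle : constExponent σ k ≤ u := h
  have hdeg : (u - constExponent σ k).degree + (constExponent σ k).degree = u.degree := by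
    rw [← map_add, tsub_add_cancel_of_le hle]
  rw [degree_constExponent] at hdeg
  have h0 : (u - constExponent σ k).degree = 0 := by omega
  rw [Finsupp.degree_eq_zero_iff] at h0
  exact le_antisymm (tsub_eq_zero_iff_le.mp h0) hle

end Exponents

/-! ### Frobenius and the Hasse invariant -/

section Frobenius

variable {σ R : Type*} [CommSemiring R] (p : ℕ) [hp : Fact p.Prime] [CharP R p]

theorem expand_map_frobenius (f : MvPolynomial σ R) :
    expand p (map (frobenius R p) f) = f ^ p := by
  have h : (expand p : MvPolynomial σ R →ₐ[R] MvPolynomial σ R).toRingHom.comp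
      (map (frobenius R p)) = frobenius (MvPolynomial σ R) p := by
    refine ringHom_ext' ?_ ?_
    · ext r
      simp [frobenius_def]
    · intro i
      simp [frobenius_def]
  exact DFunLike.congr_fun h f

theorem coeff_smul_pow_char (f : MvPolynomial σ R) (u : σ →₀ ℕ) :
    coeff (p • u) (f ^ p) = coeff u f ^ p := by
  rw [← expand_map_frobenius, coeff_expand_smul p hp.out.ne_zero, coeff_map, frobenius_def]

theorem dvd_of_coeff_pow_char_ne_zero {f : MvPolynomial σ R} {u : σ →₀ ℕ}
    (h : coeff u (f ^ p) ≠ 0) (i : σ) : p ∣ u i := by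
  contrapose! h
  rw [← expand_map_frobenius, coeff_expand_of_not_dvd _ h]

end Frobenius

section HasseInvariant

variable {σ R : Type*} [Fintype σ] [CommSemiring R] (p : ℕ) [hp : Fact p.Prime] [CharP R p]

/-- The recursion for the Hasse invariant along Frobenius. -/
theorem coeff_constExponent_pow_succ {f : MvPolynomial σ R}
    (hf : f.totalDegree ≤ Fintype.card σ) (m : ℕ) :
    coeff (constExponent σ (p ^ (m + 1) - 1)) (f ^ (p ^ (m + 1) - 1)) =
      coeff (constExponent σ (p - 1)) (f ^ (p - 1)) *
        coeff (constExponent σ (p ^ m - 1)) (f ^ (p ^ m - 1)) ^ p := by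
  classical
  have hp1 := hp.out.one_lt
  have hpm : 1 ≤ p ^ m := Nat.one_le_pow _ _ hp.out.pos
  have hsplit : p ^ (m + 1) - 1 = (p - 1) + p * (p ^ m - 1) := by
    have : p ≤ p * p ^ m := Nat.le_mul_of_pos_right _ hpm
    rw [pow_succ', Nat.mul_sub, mul_one]
    omega
  have hexp : constExponent σ (p ^ (m + 1) - 1) =
      constExponent σ (p - 1) + p • constExponent σ (p ^ m - 1) := by
    ext i
    simp [hsplit]
  rw [show f ^ (p ^ (m + 1) - 1) = f ^ (p - 1) * (f ^ (p ^ m - 1)) ^ p by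
    rw [← pow_mul, ← pow_add, hsplit, mul_comm (p ^ m - 1)], coeff_mul,
    ← coeff_smul_pow_char p]
  refine Finset.sum_eq_single (constExponent σ (p - 1), p • constExponent σ (p ^ m - 1)) ?_ ?_
  · rintro ⟨u, w⟩ huw hne
    rw [HasAntidiagonal.mem_antidiagonal] at huw
    by_contra h
    have hw := dvd_of_coeff_pow_char_ne_zero p (right_ne_zero_of_mul h)
    have hu : u.degree ≤ Fintype.card σ * (p - 1) := by
      by_contra! hlt
      refine left_ne_zero_of_mul h (coeff_eq_zero_of_totalDegree_lt_degree (lt_of_le_of_lt ?_ hlt))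
      calc (f ^ (p - 1)).totalDegree ≤ (p - 1) * f.totalDegree := totalDegree_pow _ _
        _ ≤ _ := by rw [mul_comm]; gcongr
    have hu' : u = constExponent σ (p - 1) := by
      refine eq_constExponent_of_le (fun i => ?_) hu
      have hi : u i + w i = p ^ (m + 1) - 1 := by
        simpa using DFunLike.congr_fun huw i
      have hpow : 1 ≤ p ^ (m + 1) := Nat.one_le_pow _ _ hp.out.pos
      -- Since `p` divides `w i`, `u i` is `-1` modulo `p`, so at least `p - 1`; the degree bound
      -- then leaves no slack.
      have hdvd : p ∣ u i + 1 := by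
        rw [← Nat.dvd_add_left (hw i), show u i + 1 + w i = p ^ (m + 1) by omega]
        exact dvd_pow_self p m.succ_ne_zero
      have := Nat.le_of_dvd (Nat.succ_pos _) hdvd
      omega
    refine hne (Prod.ext hu' ?_)
    rw [hexp, hu'] at huw
    exact add_left_cancel huw
  · intro h
    exact absurd (HasAntidiagonal.mem_antidiagonal.mpr hexp.symm) h

/-- Unrolled, the recursion gives a power of the coefficient for `m = 1`, with positive exponent as
`m ≠ 0`. -/
theorem coeff_constExponent_pow_eq_zero_iff [NoZeroDivisors R] {f : MvPolynomial σ R}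
    (hf : f.totalDegree ≤ Fintype.card σ) {m : ℕ} (hm : m ≠ 0) :
    coeff (constExponent σ (p ^ m - 1)) (f ^ (p ^ m - 1)) = 0 ↔
      coeff (constExponent σ (p - 1)) (f ^ (p - 1)) = 0 := by
  obtain ⟨m, rfl⟩ := Nat.exists_eq_succ_of_ne_zero hm
  refine ⟨fun h => ?_, fun h => ?_⟩
  · have : Nontrivial R := CharP.nontrivial_of_char_ne_one hp.out.ne_one
    by_contra hA
    have key : ∀ m, coeff (constExponent σ (p ^ m - 1)) (f ^ (p ^ m - 1)) ≠ 0 := by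
      intro m
      induction m with
      | zero =>
        have : constExponent σ (p ^ 0 - 1) = 0 := by ext; simp
        rw [this]
        simp
      | succ m ih =>
        rw [coeff_constExponent_pow_succ p hf]
        exact mul_ne_zero hA (pow_ne_zero _ ih)
    exact key _ h
  · rw [coeff_constExponent_pow_succ p hf, h, zero_mul]

end HasseInvariant

/-! ### Power sums over a finite field -/

section FiniteField

variable {σ K : Type*} [Fintype σ] [Field K] [Fintype K]

theorem sum_eval_monomial (d : σ →₀ ℕ) (c : K) [DecidableEq σ] :
    ∑ x : σ → K, eval x (monomial d c) = c * ∏ i, ∑ a : K, a ^ d i := by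
  simp only [eval_monomial]
  rw [← mul_sum, Finset.prod_univ_sum, Fintype.piFinset_univ]
  congr 1
  refine sum_congr rfl fun x _ => ?_
  exact Finsupp.prod_fintype _ _ fun i => pow_zero _

theorem sum_pow_card_sub_one : ∑ a : K, a ^ (Fintype.card K - 1) = -1 := by
  classical
  have h1 : Fintype.card K - 1 ≠ 0 := by have := Fintype.one_lt_card (α := K); omega
  have : ∀ a : K, a ^ (Fintype.card K - 1) = 1 - if a = 0 then 1 else 0 := by
    intro a
    split_ifs with h
    · simp [h, h1]
    · simp [FiniteField.pow_card_sub_one_eq_one a h]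
  simp [this]

/-- The sum of the values of a polynomial of degree at most `(q - 1)` times the number of
variables, over a field with `q` elements. -/
theorem sum_eval_eq_coeff [DecidableEq σ] {g : MvPolynomial σ K}
    (hg : g.totalDegree ≤ Fintype.card σ * (Fintype.card K - 1)) :
    ∑ x : σ → K, eval x g =
      (-1) ^ Fintype.card σ * coeff (constExponent σ (Fintype.card K - 1)) g := by
  have h : ∑ x : σ → K, eval x g =
      ∑ d ∈ g.support, coeff d g * ∏ i, ∑ a : K, a ^ d i := by
    simp_rw [← sum_eval_monomial]
    rw [sum_comm]
    refine sum_congr rfl fun x _ => ?_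
    conv_lhs => rw [g.as_sum, map_sum]
  rw [h, sum_eq_single (constExponent σ (Fintype.card K - 1))]
  · simp [sum_pow_card_sub_one, mul_comm]
  · intro d hd hne
    obtain ⟨i, hi⟩ : ∃ i, d i < Fintype.card K - 1 := by
      by_contra! hlt
      refine hne (eq_constExponent_of_le hlt (le_trans ?_ hg))
      rw [Finsupp.degree_apply]
      exact le_totalDegree hd
    rw [prod_eq_zero (mem_univ i) (FiniteField.sum_pow_lt_card_sub_one K _ hi), mul_zero]
  · intro hd
    rw [notMem_support_iff.mp hd, zero_mul]

end FiniteField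

end MvPolynomial

/-! ### Counting bounded tuples by generating functions -/

section Counting

open PowerSeries in
/-- The number of `n`-tuples with entries less than `q` and sum at most `d`. -/
theorem card_piFinset_range_filter_sum_le (q d n : ℕ) :
    (#{u ∈ Fintype.piFinset fun _ : Fin n => range q | ∑ i, u i ≤ d} : ℤ) =
      ∑ j ∈ range (n + 1),
        if q * j ≤ d then (-1 : ℤ) ^ j * n.choose j * ((n + (d - q * j)).choose n : ℤ) else 0 := by
  set G : ℤ⟦X⟧ := ∑ a ∈ range q, X ^ a
  set E : ℤ⟦X⟧ := PowerSeries.mk 1 with hE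
  have hGE : G = (1 - X ^ q) * E := by
    have h1 : G * (1 - X) = 1 - X ^ q := geom_sum_mul_neg X q
    have h2 : E * (1 - X) = 1 := PowerSeries.mk_one_mul_one_sub_eq_one ℤ
    calc G = G * (E * (1 - X)) := by rw [h2, mul_one]
      _ = (G * (1 - X)) * E := by ring
      _ = _ := by rw [h1]
  -- The extra factor `E` takes partial sums of coefficients, turning sum equal to `d` into sum at
  -- most `d`.
  have hleft : PowerSeries.coeff d (G ^ n * E) =
      (#{u ∈ Fintype.piFinset fun _ : Fin n => range q | ∑ i, u i ≤ d} : ℤ) := by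
    have : G ^ n = ∑ u ∈ Fintype.piFinset fun _ : Fin n => range q, X ^ ∑ i, u i := by
      have h := Finset.prod_univ_sum (fun _ : Fin n => range q) fun _ a => (X ^ a : ℤ⟦X⟧)
      rw [prod_const, card_univ, Fintype.card_fin] at h
      exact h.trans (sum_congr rfl fun u _ => prod_pow_eq_pow_sum _ _ _)
    rw [this, sum_mul, map_sum]
    simp [PowerSeries.coeff_X_pow_mul', hE]
  have hright : G ^ n * E = ∑ j ∈ range (n + 1),
      X ^ (q * j) * (PowerSeries.C ((-1 : ℤ) ^ j * n.choose j) * E ^ (n + 1)) := by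
    have hbin : (1 - X ^ q : ℤ⟦X⟧) ^ n = ∑ j ∈ range (n + 1),
        X ^ (q * j) * PowerSeries.C ((-1 : ℤ) ^ j * n.choose j) := by
      rw [sub_eq_neg_add, add_pow]
      refine sum_congr rfl fun j _ => ?_
      rw [neg_pow, one_pow, mul_one, ← pow_mul]
      simp only [map_mul, map_pow, map_neg, map_one, map_natCast]
      ring
    rw [hGE, mul_pow, mul_assoc, ← pow_succ, hbin, sum_mul]
    exact sum_congr rfl fun j _ => mul_assoc _ _ _
  rw [← hleft, hright, map_sum]
  refine sum_congr rfl fun j _ => ?_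
  rw [PowerSeries.coeff_X_pow_mul']
  refine if_congr Iff.rfl ?_ rfl
  rw [PowerSeries.coeff_C_mul, hE, PowerSeries.mk_one_pow_eq_mk_choose_add, PowerSeries.coeff_mk]

end Counting

open MvPolynomial

/-! ### The weight modulo the characteristic -/

section Weight

variable {K : Type*} [Field K] [Fintype K] {n : ℕ}

theorem codewordWeight_cast (f : MvPolynomial (Fin n) K) :
    (codewordWeight f : K) = ∑ x : Fin n → K, eval x (f ^ (Fintype.card K - 1)) := by
  classical
  have h1 : Fintype.card K - 1 ≠ 0 := by have := Fintype.one_lt_card (α := K); omega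
  have : ∀ x : Fin n → K,
      eval x (f ^ (Fintype.card K - 1)) = if eval x f ≠ 0 then 1 else 0 := by
    intro x
    rw [map_pow]
    split_ifs with h
    · exact FiniteField.pow_card_sub_one_eq_one _ h
    · rw [not_not.mp h, zero_pow h1]
  simp only [this, sum_boole, codewordWeight, hammingNorm]

theorem char_dvd_codewordWeight_iff (p : ℕ) [hp : Fact p.Prime] [CharP K p] {m : ℕ}
    (hK : Fintype.card K = p ^ m) {f : MvPolynomial (Fin n) K} (hf : f.totalDegree ≤ n) :
    p ∣ codewordWeight f ↔
      coeff (constExponent (Fin n) (p - 1)) (f ^ (p - 1)) = 0 := by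
  have hm : m ≠ 0 := by
    rintro rfl
    exact Fintype.one_lt_card.ne' (hK.trans (pow_zero p))
  have hf' : f.totalDegree ≤ Fintype.card (Fin n) := by simpa using hf
  rw [← CharP.cast_eq_zero_iff K p, codewordWeight_cast, sum_eval_eq_coeff, hK,
    mul_eq_zero_iff_left (pow_ne_zero _ (neg_ne_zero.mpr one_ne_zero)),
    coeff_constExponent_pow_eq_zero_iff p hf' hm]
  refine (totalDegree_pow _ _).trans ?_
  rw [mul_comm]
  gcongr

end Weight

/-! ### Zeros of the quadratic form -/

section Equidistribution

/-- A function `t` which takes every value equally often because it admits unit-speed shifts. -/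
theorem Nat.card_eq_mul_card_of_shift {K V : Type*} [Ring K] [AddCommGroup V] [Module K V]
    (t : V → K) (e : V → V) (he : ∀ (v : V) (c : K), e (v + c • e v) = e v)
    (ht : ∀ (v : V) (c : K), t (v + c • e v) = t v + c) :
    Nat.card V = Nat.card {v // t v = 0} * Nat.card K := by
  rw [← Nat.card_prod]
  have ht0 : ∀ v, t (v + (-t v) • e v) = 0 := fun v => by rw [ht, add_neg_cancel]
  refine Nat.card_congr
    { toFun := fun v => (⟨v + (-t v) • e v, ht0 v⟩, t v)
      invFun := fun w => w.1 + w.2 • e w.1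
      left_inv := fun v => ?_
      right_inv := fun w => ?_ }
  · simp only [he]
    rw [neg_smul, neg_add_cancel_right]
  · obtain ⟨⟨v, hv⟩, c⟩ := w
    have h : t (v + c • e v) = c := by rw [ht, hv, zero_add]
    refine Prod.ext (Subtype.ext ?_) h
    simp [he, h]

end Equidistribution

section QuadraticForm

variable {K : Type*} [Field K] {n : ℕ}

/-- The exponent vectors of degree `n`, at most `2` in each variable, that come before their
complement in the lexicographic order. -/
def lowerExponents (n : ℕ) : Set (Fin n →₀ ℕ) :=
  {u | u.degree = n ∧ ∃ v, u + v = constExponent (Fin n) 2 ∧ toLex u < toLex v}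

open Classical in
/-- The coefficients of `f` at the exponents in `lowerExponents n`. -/
noncomputable def lowerCoeff (f : MvPolynomial (Fin n) K) (u : Fin n →₀ ℕ) : K :=
  if u ∈ lowerExponents n then coeff u f else 0

open Classical in
/-- A direction, depending only on the lower coefficients, along which the coefficient of
`f ^ 2` at `(2, …, 2)` (or the coefficient of `f` at `(1, …, 1)`, if all lower coefficients vanish)
grows with unit speed. -/
noncomputable def shiftDirection (y : (Fin n →₀ ℕ) → K) : MvPolynomial (Fin n) K :=
  if h : ∃ u, y u ≠ 0 then
    monomial (constExponent (Fin n) 2 - h.choose) (2 * y h.choose)⁻¹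
  else monomial (constExponent (Fin n) 1) 1

open Classical in
/-- The function of `f` that grows with unit speed along `shiftDirection (lowerCoeff f)`. -/
noncomputable def shiftParameter (f : MvPolynomial (Fin n) K) : K :=
  if ∃ u, lowerCoeff f u ≠ 0 then coeff (constExponent (Fin n) 2) (f ^ 2)
  else coeff (constExponent (Fin n) 1) f

theorem mem_lowerExponents_of_lowerCoeff_ne_zero {f : MvPolynomial (Fin n) K} {u : Fin n →₀ ℕ}
    (h : lowerCoeff f u ≠ 0) : u ∈ lowerExponents n ∧ lowerCoeff f u = coeff u f := by
  unfold lowerCoeff at h ⊢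
  split_ifs at h ⊢ with hu
  · exact ⟨hu, rfl⟩
  · exact absurd rfl h

theorem sub_notMem_lowerExponents {u v : Fin n →₀ ℕ} (huv : u + v = constExponent (Fin n) 2)
    (hlt : toLex u < toLex v) : v ∉ lowerExponents n := by
  rintro ⟨-, w, hw, hvw⟩
  have : w = u := add_left_cancel (hw.trans (huv.symm.trans (add_comm u v)))
  exact lt_asymm hlt (this ▸ hvw)

theorem constExponent_one_notMem_lowerExponents :
    constExponent (Fin n) 1 ∉ lowerExponents n := by
  rintro ⟨-, w, hw, hlt⟩
  have : w = constExponent (Fin n) 1 := by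
    refine add_left_cancel (hw.trans ?_)
    ext i
    simp
  exact lt_irrefl _ (this ▸ hlt)

/-- The exponent and coefficient of the shift direction. -/
theorem shiftDirection_lowerCoeff_cases (f : MvPolynomial (Fin n) K) :
    (∃ u v, u.degree = n ∧ u + v = constExponent (Fin n) 2 ∧ toLex u < toLex v ∧
      coeff u f ≠ 0 ∧ (∃ u, lowerCoeff f u ≠ 0) ∧
      shiftDirection (lowerCoeff f) = monomial v (2 * coeff u f)⁻¹) ∨
    ((∀ u, lowerCoeff f u = 0) ∧
      shiftDirection (lowerCoeff f) = monomial (constExponent (Fin n) 1) 1) := by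
  by_cases h : ∃ u, lowerCoeff f u ≠ 0
  · left
    obtain ⟨⟨hdeg, v, huv, hlt⟩, hu⟩ := mem_lowerExponents_of_lowerCoeff_ne_zero h.choose_spec
    refine ⟨h.choose, v, hdeg, huv, hlt, hu ▸ h.choose_spec, h, ?_⟩
    rw [shiftDirection, dif_pos h, hu, ← huv, add_tsub_cancel_left]
  · right
    refine ⟨by simpa using h, ?_⟩
    rw [shiftDirection, dif_neg h]

theorem lowerCoeff_add_smul_monomial {v : Fin n →₀ ℕ} (hv : v ∉ lowerExponents n)
    (f : MvPolynomial (Fin n) K) (c b : K) :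
    lowerCoeff (f + c • monomial v b) = lowerCoeff f := by
  classical
  funext u
  unfold lowerCoeff
  split_ifs with hu
  · have : v ≠ u := fun h => hv (h ▸ hu)
    simp [coeff_monomial, this]
  · rfl

/-- The shift only touches an upper or the middle exponent, so its direction is constant along each
line and the shifts are invertible. -/
theorem lowerCoeff_shift (f : MvPolynomial (Fin n) K) (c : K) :
    lowerCoeff (f + c • shiftDirection (lowerCoeff f)) = lowerCoeff f := by
  obtain ⟨u, v, -, huv, hlt, -, -, he⟩ | ⟨-, he⟩ := shiftDirection_lowerCoeff_cases f
  · rw [he, lowerCoeff_add_smul_monomial (sub_notMem_lowerExponents huv hlt)]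
  · rw [he, lowerCoeff_add_smul_monomial constExponent_one_notMem_lowerExponents]

theorem shiftParameter_shift (h2 : (2 : K) ≠ 0) (f : MvPolynomial (Fin n) K) (c : K) :
    shiftParameter (f + c • shiftDirection (lowerCoeff f)) = shiftParameter f + c := by
  classical
  unfold shiftParameter
  rw [lowerCoeff_shift]
  obtain ⟨u, v, -, huv, hlt, hu, hex, he⟩ | ⟨hall, he⟩ := shiftDirection_lowerCoeff_cases f
  · rw [if_pos hex, if_pos hex, he]
    -- The direction is isotropic: only the cross term, linear in `c`, contributes.
    have hvv : v + v ≠ constExponent (Fin n) 2 := by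
      rw [← huv]
      intro h
      exact hlt.ne (congrArg toLex (add_right_cancel h).symm)
    have hexpand : (f + c • monomial v (2 * coeff u f)⁻¹) ^ 2 = f ^ 2 +
        f * monomial v (2 * (c * (2 * coeff u f)⁻¹)) +
        monomial (v + v) ((c * (2 * coeff u f)⁻¹) * (c * (2 * coeff u f)⁻¹)) := by
      rw [← monomial_mul, smul_monomial, smul_eq_mul, two_mul (c * _), map_add]
      ring
    rw [hexpand, coeff_add, coeff_add, coeff_monomial, if_neg hvv, add_zero, ← huv,
      coeff_mul_monomial]
    field_simp
  · have hex : ¬ ∃ u, lowerCoeff f u ≠ 0 := by simpa using hall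
    rw [if_neg hex, if_neg hex, he]
    simp

/-- On polynomials of degree at most `n`, the shift parameter has the same zeros as the
coefficient of the square at `(2, …, 2)`. -/
theorem shiftParameter_eq_zero_iff {f : MvPolynomial (Fin n) K} (hf : f.totalDegree ≤ n) :
    shiftParameter f = 0 ↔ coeff (constExponent (Fin n) 2) (f ^ 2) = 0 := by
  classical
  unfold shiftParameter
  split_ifs with hex
  · rfl
  push Not at hex
  -- Complementary degrees add up to `2 * n`: unless both equal `n`, one exceeds `deg f`.
  have hlow : ∀ u v, u + v = constExponent (Fin n) 2 → toLex u < toLex v →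
      coeff u f * coeff v f = 0 := by
    intro u v huv hlt
    have hdeg : u.degree + v.degree = n * 2 := by
      rw [← map_add, huv, degree_constExponent, Fintype.card_fin]
    rcases lt_trichotomy u.degree n with h | h | h
    · rw [coeff_eq_zero_of_totalDegree_lt_degree (f := f) (u := v) (by omega), mul_zero]
    · have := hex u
      rw [lowerCoeff, if_pos ⟨h, v, huv, hlt⟩] at this
      rw [this, zero_mul]
    · rw [coeff_eq_zero_of_totalDegree_lt_degree (f := f) (u := u) (by omega), zero_mul]
  have hsq : coeff (constExponent (Fin n) 2) (f ^ 2) =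
      coeff (constExponent (Fin n) 1) f * coeff (constExponent (Fin n) 1) f := by
    rw [pow_two, coeff_mul]
    refine Finset.sum_eq_single (constExponent (Fin n) 1, constExponent (Fin n) 1) ?_ ?_
    · rintro ⟨u, v⟩ huv hne
      rw [HasAntidiagonal.mem_antidiagonal] at huv
      rcases lt_trichotomy (toLex u) (toLex v) with h | h | h
      · exact hlow u v huv h
      · obtain rfl : u = v := toLex.injective h
        have : u = constExponent (Fin n) 1 := by
          ext i
          have : u i + u i = 2 := by simpa using DFunLike.congr_fun huv i
          rw [constExponent_apply]
          omega
        exact absurd (by rw [this]) hne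
      · rw [mul_comm]
        exact hlow v u ((add_comm v u).trans huv) h
    · intro h
      refine absurd (HasAntidiagonal.mem_antidiagonal.mpr ?_) h
      ext i
      simp
  rw [hsq, mul_self_eq_zero]

end QuadraticForm

/-! ### The shifts inside the Reed-Muller code -/

section ReedMuller

variable {K : Type*} [Field K] [Fintype K]

/-- The exponent vectors of the monomials in the Reed-Muller code. -/
def reedMullerExponents (q d n : ℕ) : Set (Fin n →₀ ℕ) :=
  {u | u.degree ≤ d ∧ ∀ i, u i ≤ q - 1}

theorem reedMuller_eq_restrictSupport (d n : ℕ) :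
    reedMuller K d n = restrictSupport K (reedMullerExponents (Fintype.card K) d n) := by
  ext f
  simp only [reedMuller, Submodule.mem_inf, restrictTotalDegree, restrictDegree,
    mem_restrictSupport_iff, ← Set.subset_inter_iff]
  rfl

/-- Complementing in `(2, …, 2)` preserves degree `n`, and entries stay at most `2 ≤ q - 1`. -/
theorem shiftDirection_mem_reedMuller {n : ℕ} (hK : 3 ≤ Fintype.card K)
    (f : MvPolynomial (Fin n) K) :
    shiftDirection (lowerCoeff f) ∈ reedMuller K n n := by
  rw [reedMuller_eq_restrictSupport]
  obtain ⟨u, v, hdeg, huv, -, -, -, he⟩ | ⟨-, he⟩ := shiftDirection_lowerCoeff_cases f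
  · rw [he, monomial_mem_restrictSupport]
    refine Or.inl ⟨?_, fun i => ?_⟩
    · have : u.degree + v.degree = n * 2 := by
        rw [← map_add, huv, degree_constExponent, Fintype.card_fin]
      omega
    · have : u i + v i = 2 := by simpa using DFunLike.congr_fun huv i
      omega
  · rw [he, monomial_mem_restrictSupport]
    refine Or.inl ⟨?_, fun i => ?_⟩
    · rw [degree_constExponent, Fintype.card_fin, mul_one]
    · rw [constExponent_apply]
      omega

theorem card_reedMuller_eq_mul {n : ℕ} (h2 : (2 : K) ≠ 0) (hK : 3 ≤ Fintype.card K) :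
    Nat.card (reedMuller K n n) =
      {f | f ∈ reedMuller K n n ∧ coeff (constExponent (Fin n) 2) (f ^ 2) = 0}.ncard *
        Fintype.card K := by
  have h := Nat.card_eq_mul_card_of_shift (K := K) (V := reedMuller K n n)
    (fun f => shiftParameter (f : MvPolynomial (Fin n) K))
    (fun f => ⟨shiftDirection (lowerCoeff (f : MvPolynomial (Fin n) K)),
      shiftDirection_mem_reedMuller hK _⟩)
    (fun f c => Subtype.ext (by simp [lowerCoeff_shift]))
    (fun f c => by simpa using shiftParameter_shift h2 (f : MvPolynomial (Fin n) K) c)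
  rw [h, Nat.card_eq_fintype_card (α := K), ← Nat.card_coe_set_eq]
  congr 1
  refine Nat.card_congr ((Equiv.subtypeSubtypeEquivSubtypeInter
    (fun f => f ∈ reedMuller K n n) fun f => shiftParameter f = 0).trans
    (Equiv.subtypeEquivRight fun f => and_congr_right fun hf => ?_))
  exact shiftParameter_eq_zero_iff (mem_reedMuller.mp hf).1

end ReedMuller

/-! ### The dimension formula and the conclusion -/

section Dimension

/-- The exponents of the Reed-Muller code as a finite set of tuples. -/
noncomputable def reedMullerExponentsEquiv (q d n : ℕ) (hq : q ≠ 0) :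
    reedMullerExponents q d n ≃
      {u ∈ Fintype.piFinset fun _ : Fin n => range q | ∑ i, u i ≤ d} :=
  Finsupp.equivFunOnFinite.subtypeEquiv fun u => by
    simp only [reedMullerExponents, Set.mem_ofPred_eq, mem_filter, Fintype.mem_piFinset, mem_range,
      Finsupp.degree_eq_sum, Finsupp.equivFunOnFinite_apply, Nat.le_sub_one_iff_lt
        (Nat.pos_of_ne_zero hq)]
    exact and_comm

theorem card_reedMullerExponents (q d n : ℕ) (hq : q ≠ 0) :
    Nat.card (reedMullerExponents q d n) =
      #{u ∈ Fintype.piFinset fun _ : Fin n => range q | ∑ i, u i ≤ d} := by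
  rw [Nat.card_congr (reedMullerExponentsEquiv q d n hq), Nat.card_eq_fintype_card,
    Fintype.card_coe]

variable {K : Type*} [Field K] [Fintype K]

instance finite_reedMuller (d n : ℕ) : Module.Finite K (reedMuller K d n) := by
  have : Finite (reedMullerExponents (Fintype.card K) d n) :=
    Finite.of_equiv _ (reedMullerExponentsEquiv _ d n Fintype.card_ne_zero).symm
  rw [reedMuller_eq_restrictSupport]
  exact Module.Finite.of_basis (basisRestrictSupport K _)

theorem finrank_reedMuller (d n : ℕ) :
    Module.finrank K (reedMuller K d n) =
      Nat.card (reedMullerExponents (Fintype.card K) d n) := by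
  rw [reedMuller_eq_restrictSupport]
  exact Module.finrank_eq_nat_card_basis (basisRestrictSupport K _)

theorem finrank_reedMuller_self (n : ℕ) :
    (Module.finrank K (reedMuller K n n) : ℤ) =
      ∑ j ∈ range (n / Fintype.card K + 1),
        (-1 : ℤ) ^ j * (n.choose j : ℤ) * ((2 * n - Fintype.card K * j).choose n : ℤ) := by
  have hq : 0 < Fintype.card K := Fintype.card_pos
  rw [finrank_reedMuller, card_reedMullerExponents _ _ _ hq.ne',
    card_piFinset_range_filter_sum_le, ← sum_filter]
  refine sum_congr ?_ fun j hj => ?_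
  · ext j
    simp only [mem_filter, mem_range, Nat.lt_succ_iff, Nat.le_div_iff_mul_le hq]
    rw [mul_comm j]
    refine and_iff_right_of_imp fun h => ?_
    exact (Nat.le_mul_of_pos_left j hq).trans h
  · have : Fintype.card K * j ≤ n := by
      rw [mem_range, Nat.lt_succ_iff, Nat.le_div_iff_mul_le hq] at hj
      rwa [mul_comm]
    congr 3
    omega

end Dimension

theorem corollary3p7 (K : Type*) [Field K] [Fintype K] (q m n : ℕ) (hq : q = 3 ^ m)
    (hK : Fintype.card K = q) (hn : 2 ≤ n) :
    {f : MvPolynomial (Fin n) K | f ∈ reedMuller K n n ∧ 3 ∣ codewordWeight f}.ncard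
        = q ^ (Module.finrank K (reedMuller K n n) - 1) ∧
      (Module.finrank K (reedMuller K n n) : ℤ)
        = ∑ j ∈ Finset.range (n / q + 1),
            (-1 : ℤ) ^ j * (n.choose j : ℤ) * ((2 * n - q * j).choose n : ℤ) := by
  subst hK
  refine ⟨?_, finrank_reedMuller_self n⟩
  have : Fact (Nat.Prime 3) := ⟨Nat.prime_three⟩
  have hm : m ≠ 0 := by
    rintro rfl
    have := Fintype.one_lt_card (α := K)
    omega
  have : CharP K 3 := by
    refine charP_of_card_eq_prime_pow hq
  have h2 : (2 : K) ≠ 0 := by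
    intro h
    have := (CharP.cast_eq_zero_iff K 3 2).mp (by exact_mod_cast h)
    omega
  have h3 : 3 ≤ Fintype.card K := hq ▸ Nat.le_self_pow hm 3
  have hset : {f : MvPolynomial (Fin n) K | f ∈ reedMuller K n n ∧ 3 ∣ codewordWeight f} =
      {f | f ∈ reedMuller K n n ∧ coeff (constExponent (Fin n) 2) (f ^ 2) = 0} := by
    ext f
    exact and_congr_right fun hf => char_dvd_codewordWeight_iff 3 hq (mem_reedMuller.mp hf).1
  have hcard := card_reedMuller_eq_mul (n := n) h2 h3
  rw [Module.natCard_eq_pow_finrank (K := K), Nat.card_eq_fintype_card, ← hset] at hcard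
  rcases hr : Module.finrank K (reedMuller K n n) with _ | r
  -- Dimension zero, where `r - 1` would truncate, is impossible: `q` would divide `1`.
  · rw [hr, pow_zero] at hcard
    have := Nat.eq_one_of_mul_eq_one_left hcard.symm
    omega
  · rw [hr, pow_succ] at hcard
    exact (Nat.eq_of_mul_eq_mul_right Fintype.card_pos hcard).symm
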